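/- For a continuous map $f:X\to Y$ of topological spaces write $x_0\sim x_1$ (respectively $x_0\sim_{\mathrm p}x_1$) if $f(x_0)=f(x_1)$ and $x_0,x_1$ lie in the same connected component (respectively the same path-component) of the level set $f^{-1}(f(x_0))$. The Reeb space of $f$ is the quotient space $W_f=X/\!\sim$ and the path Reeb space of $f$ is the quotient space $W_f^{\mathrm p}=X/\!\sim_{\mathrm p}$, both with the quotient topology; the Reeb map $W_f\to Y$ and the path Reeb map $W_f^{\mathrm p}\to Y$ are the maps induced by $f$. **Proposition 4.3.** Let $M$ be a closed $C^\infty$ manifold (compact, Hausdorff, without boundary) of any dimension $m\ge 0$, not necessarily connected, and let $f:M\to\mathbb R$ be a $C^\infty$ function with finitely many critical points (points at which $df$ vanishes). Then $W_f=W_f^{\mathrm p}$: the relations $\sim$ and $\sim_{\mathrm p}$ on $M$ coincide, so that the identity of $M$ induces a homeomorphism $W_f\to W_f^{\mathrm p}$ compatible with the quotient maps and with the Reeb and path Reeb maps. In other words, for every $y\in\mathbb R$ the connected components and the path-components of $f^{-1}(y)$ are the same. -/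

import Mathlib

open scoped Manifold ContDiff

/-- The relation `x₀ ∼ x₁`: `f x₀ = f x₁`, and `x₀`, `x₁` lie on the same connected component of
the level set `f⁻¹(f x₀) = f⁻¹(f x₁)`. -/
def reebSetoid {X Y : Type*} [TopologicalSpace X] (f : X → Y) : Setoid X where
  r x₀ x₁ := f x₀ = f x₁ ∧ x₁ ∈ connectedComponentIn (f ⁻¹' {f x₀}) x₀
  iseqv :=
    { refl := fun _ => ⟨rfl, mem_connectedComponentIn rfl⟩
      symm := by
        rintro x y ⟨h, hc⟩
        refine ⟨h.symm, ?_⟩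
        rw [← h, ← connectedComponentIn_eq hc]
        exact mem_connectedComponentIn rfl
      trans := by
        rintro x y z ⟨h, hc⟩ ⟨h', hc'⟩
        refine ⟨h.trans h', ?_⟩
        rw [← h] at hc'
        rw [connectedComponentIn_eq hc]
        exact hc' }

/-- The relation `x₀ ∼ₚ x₁`: `f x₀ = f x₁`, and `x₀`, `x₁` lie on the same path-component of
the level set `f⁻¹(f x₀) = f⁻¹(f x₁)`. -/
def pathReebSetoid {X Y : Type*} [TopologicalSpace X] (f : X → Y) : Setoid X where
  r x₀ x₁ := f x₀ = f x₁ ∧ x₁ ∈ pathComponentIn (f ⁻¹' {f x₀}) x₀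
  iseqv :=
    { refl := fun _ => ⟨rfl, mem_pathComponentIn_self rfl⟩
      symm := by
        rintro x y ⟨h, hc⟩
        refine ⟨h.symm, ?_⟩
        rw [← h]
        exact JoinedIn.symm hc
      trans := by
        rintro x y z ⟨h, hc⟩ ⟨h', hc'⟩
        refine ⟨h.trans h', ?_⟩
        rw [← h] at hc'
        exact JoinedIn.trans hc hc' }

/-- The Reeb space `W_f = X / ∼`. -/
def ReebSpace {X Y : Type*} [TopologicalSpace X] (f : X → Y) : Type _ :=
  Quotient (reebSetoid f)

/-- The path Reeb space `W_f^p = X / ∼ₚ`. -/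
def PathReebSpace {X Y : Type*} [TopologicalSpace X] (f : X → Y) : Type _ :=
  Quotient (pathReebSetoid f)

/-- The Reeb space carries the quotient topology. -/
instance {X Y : Type*} [TopologicalSpace X] (f : X → Y) : TopologicalSpace (ReebSpace f) :=
  inferInstanceAs (TopologicalSpace (Quotient (reebSetoid f)))

/-- The path Reeb space carries the quotient topology. -/
instance {X Y : Type*} [TopologicalSpace X] (f : X → Y) : TopologicalSpace (PathReebSpace f) :=
  inferInstanceAs (TopologicalSpace (Quotient (pathReebSetoid f)))

/-- The quotient map `q_f : X → W_f`. -/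
def ReebSpace.mk {X Y : Type*} [TopologicalSpace X] (f : X → Y) (x : X) : ReebSpace f :=
  Quotient.mk (reebSetoid f) x

/-- The quotient map `q_f^p : X → W_f^p`. -/
def PathReebSpace.mk {X Y : Type*} [TopologicalSpace X] (f : X → Y) (x : X) : PathReebSpace f :=
  Quotient.mk (pathReebSetoid f) x

/-- The Reeb map `W_f → Y` induced by `f`. -/
def ReebSpace.reebMap {X Y : Type*} [TopologicalSpace X] (f : X → Y) : ReebSpace f → Y :=
  Quotient.lift f (fun _ _ h => h.1)

/-- The path Reeb map `W_f^p → Y` induced by `f`. -/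
def PathReebSpace.reebMap {X Y : Type*} [TopologicalSpace X] (f : X → Y) : PathReebSpace f → Y :=
  Quotient.lift f (fun _ _ h => h.1)

/-- The set of critical points of a smooth real-valued function on an `m`-dimensional manifold
without boundary: the points at which its differential vanishes. -/
def criticalPoints {m : ℕ} {M : Type*} [TopologicalSpace M]
    [ChartedSpace (EuclideanSpace ℝ (Fin m)) M] (f : M → ℝ) : Set M :=
  {x | mfderiv (𝓡 m) 𝓘(ℝ, ℝ) f x = 0}

/-! By the implicit function theorem a level set is locally path-connected at its non-critical
points, so it is a compact metrizable space with finitely many possibly bad points. Each of its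
connected components C inherits this, and the crux is that C is path-connected
(`joined_of_locPathConnectedAt_compl_finite`). It suffices that every union A of path-components of
C is closed: a path-component and its complement are then both closed. Let q be in the closure of A
but not in A. Some path-component of a small punctured ball around q lies in A and accumulates at q
(`exists_pathComponentIn_punctured_ball`). Iterating inside it with shrinking balls gives paths that
concatenate to one from A to q (`Joined.of_tendsto_smallSets`), a contradiction. -/

open Set Filter Topology

/-! ### Infinite concatenation of paths -/

section InfiniteConcatenation

variable {X : Type*} [TopologicalSpace X]

/-- The concatenation of the paths `γ 0, γ 1, …`, parametrised by `[0, ∞)`. -/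
noncomputable def Path.infiniteConcat {x : ℕ → X} (γ : ∀ n, Path (x n) (x (n + 1))) (t : ℝ) : X :=
  (γ ⌊t⌋₊).extend (t - ⌊t⌋₊)

theorem Path.infiniteConcat_eqOn {x : ℕ → X} (γ : ∀ n, Path (x n) (x (n + 1))) (n : ℕ) :
    EqOn (Path.infiniteConcat γ) (fun t => (γ n).extend (t - n)) (Icc (n : ℝ) (n + 1)) := by
  rintro t ⟨h1, h2⟩
  rcases h2.lt_or_eq with h | h
  · have : ⌊t⌋₊ = n := (Nat.floor_eq_iff ((Nat.cast_nonneg n).trans h1)).2 ⟨h1, h⟩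
    rw [Path.infiniteConcat, this]
  -- At the right endpoint the floor jumps to the next path, which starts where `γ n` ends.
  · have : ⌊t⌋₊ = n + 1 := by
      rw [h]; exact_mod_cast Nat.floor_natCast (R := ℝ) (n + 1)
    rw [Path.infiniteConcat, this]
    simp [h]

theorem Path.continuousOn_infiniteConcat {x : ℕ → X} (γ : ∀ n, Path (x n) (x (n + 1))) :
    ContinuousOn (Path.infiniteConcat γ) (Ici 0) := by
  have hlf : LocallyFinite (fun n : ℕ => Icc (n : ℝ) (n + 1)) := by
    refine fun t => ⟨Iio (t + 1), Iio_mem_nhds (lt_add_one t),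
      (finite_Iio ⌈t + 1⌉₊).subset ?_⟩
    rintro n ⟨s, hns, hst⟩
    exact Nat.lt_ceil.2 (hns.1.trans_lt hst)
  have h := hlf.continuousOn_iUnion (g := Path.infiniteConcat γ) (fun n => isClosed_Icc) fun n =>
    ContinuousOn.congr (by fun_prop) (Path.infiniteConcat_eqOn γ n)
  refine h.mono fun t ht => mem_iUnion.2 ⟨⌊t⌋₊, Nat.floor_le ht, (Nat.lt_floor_add_one t).le⟩

/-- Infinitely many paths whose images shrink to a point `q` concatenate to a path ending at `q`. -/
theorem Joined.of_tendsto_smallSets {x : ℕ → X} {q : X} {B : ℕ → Set X}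
    (hB : Tendsto B atTop (𝓝 q).smallSets) (h : ∀ n, JoinedIn (B n) (x n) (x (n + 1))) :
    Joined (x 0) q := by
  let γ : ∀ n, Path (x n) (x (n + 1)) := fun n => (h n).somePath
  have hγ : ∀ t, Path.infiniteConcat γ t ∈ B ⌊t⌋₊ := fun t => (h _).somePath_mem _
  have hlim : Tendsto (Path.infiniteConcat γ) atTop (𝓝 q) := by
    intro U hU
    have h1 : ∀ᶠ n in atTop, B n ⊆ U := hB.eventually (eventually_smallSets_subset.2 hU)
    exact ((tendsto_nat_floor_atTop (α := ℝ)).eventually h1).mono fun t ht => ht (hγ t)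
  -- `s / (1 - s)` carries `[0, 1)` onto `[0, ∞)`; the limit `q` fills in `s = 1`.
  let F : ℝ → X := fun s => if s < 1 then Path.infiniteConcat γ (s / (1 - s)) else q
  have hF : ContinuousOn F (Icc 0 1) := by
    intro s hs
    rcases hs.2.lt_or_eq with hs1 | rfl
    · have h1 : ContinuousWithinAt (fun s : ℝ => Path.infiniteConcat γ (s / (1 - s)))
          (Icc 0 1) s := by
        refine ContinuousWithinAt.comp (t := Ici 0) (f := fun s : ℝ => s / (1 - s))
          (Path.continuousOn_infiniteConcat γ _ (div_nonneg hs.1 (sub_nonneg.2 hs.2))) ?_ ?_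
        · exact (continuousAt_id.div (continuousAt_const.sub continuousAt_id)
            (sub_pos.2 hs1).ne').continuousWithinAt
        · intro u hu
          exact div_nonneg hu.1 (by linarith [hu.2])
      refine h1.congr_of_eventuallyEq ?_ (if_pos hs1)
      filter_upwards [mem_nhdsWithin_of_mem_nhds (Iio_mem_nhds hs1)] with u hu using if_pos hu
    · have hF1 : F 1 = q := if_neg (lt_irrefl _)
      rw [ContinuousWithinAt, hF1]
      have h2 : Tendsto (fun s : ℝ => s / (1 - s)) (𝓝[<] 1) atTop := by
        have h3 : Tendsto (fun s : ℝ => (1 - s)⁻¹) (𝓝[<] 1) atTop := by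
          refine tendsto_inv_nhdsGT_zero.comp (tendsto_nhdsWithin_iff.2 ⟨?_, ?_⟩)
          · have : Tendsto (fun s : ℝ => 1 - s) (𝓝 1) (𝓝 (1 - 1)) :=
              (continuous_const.sub continuous_id).tendsto 1
            rw [sub_self] at this
            exact this.mono_left nhdsWithin_le_nhds
          · filter_upwards [self_mem_nhdsWithin] with s hs
            exact sub_pos.2 (mem_Iio.1 hs)
        have h4 : Tendsto (fun s : ℝ => s) (𝓝[<] 1) (𝓝 1) :=
          tendsto_id.mono_left nhdsWithin_le_nhds
        simpa only [div_eq_mul_inv] using h4.pos_mul_atTop one_pos h3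
      have h5 : Tendsto F (𝓝[<] 1) (𝓝 q) := by
        refine (hlim.comp h2).congr' ?_
        filter_upwards [self_mem_nhdsWithin] with s hs
        exact (if_pos hs).symm
      have h6 : Tendsto F (𝓝[≤] 1) (𝓝 q) := by
        rw [← Iio_insert, nhdsWithin_insert, tendsto_sup]
        refine ⟨?_, h5⟩
        rw [tendsto_pure_left]
        intro s hs
        rw [hF1]
        exact mem_of_mem_nhds hs
      exact h6.mono_left (nhdsWithin_mono _ fun s hs => hs.2)
  refine (JoinedIn.ofLine (F := univ) (f := F) hF ?_ ?_ (subset_univ _)).joined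
  · simp [F, Path.infiniteConcat]
  · simp [F]

end InfiniteConcatenation

/-- `X` is locally path-connected at the point `x`. -/
def LocPathConnectedAt {X : Type*} [TopologicalSpace X] (x : X) : Prop :=
  ∀ U ∈ 𝓝 x, ∃ V ∈ 𝓝 x, IsPathConnected V ∧ V ⊆ U

section LocPathConnectedAt

variable {X : Type*} [TopologicalSpace X]

theorem LocPathConnectedAt.isOpen_pathComponentIn {U : Set X} (hU : IsOpen U)
    (h : ∀ x ∈ U, LocPathConnectedAt x) (x : X) : IsOpen (pathComponentIn U x) := by
  refine isOpen_iff_mem_nhds.2 fun y hy => ?_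
  have hyU : y ∈ U := pathComponentIn_subset hy
  obtain ⟨V, hV, hVc, hVU⟩ := h y hyU U (hU.mem_nhds hyU)
  rw [← pathComponentIn_congr hy]
  exact mem_of_superset hV (hVc.subset_pathComponentIn (mem_of_mem_nhds hV) hVU)

theorem LocPathConnectedAt.mem_pathComponentIn_of_mem_closure {U : Set X} (hU : IsOpen U) {x y : X}
    (hyU : y ∈ U) (h : LocPathConnectedAt y) (hy : y ∈ closure (pathComponentIn U x)) :
    y ∈ pathComponentIn U x := by
  obtain ⟨V, hV, hVc, hVU⟩ := h U (hU.mem_nhds hyU)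
  obtain ⟨z, hzV, hz⟩ := mem_closure_iff_nhds.1 hy V hV
  exact JoinedIn.trans hz ((hVc.joinedIn z hzV y (mem_of_mem_nhds hV)).mono hVU)

end LocPathConnectedAt

/-! ### Compact connected spaces with finitely many bad points -/

section FinitelyManyBadPoints

variable {X : Type*} [MetricSpace X] [CompactSpace X] [PreconnectedSpace X]

/-- If `q` is the only point of the closed ball of radius `r` where local path-connectedness may
fail, then a set accumulating at `q` and saturated for the path-components of the punctured ball
contains one of these path-components that accumulates at `q`. -/
theorem exists_pathComponentIn_punctured_ball {q : X} {r : ℝ} (hr : 0 < r)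
    (hloc : ∀ x ∈ Metric.ball q r, x ≠ q → LocPathConnectedAt x) {A : Set X} (hqA : q ∈ closure A)
    (hq : q ∉ A)
    (hA : ∀ x ∈ A, pathComponentIn (Metric.ball q r \ {q}) x ⊆ A) :
    ∃ x ∈ A, q ∈ closure (pathComponentIn (Metric.ball q r \ {q}) x) := by
  set B := Metric.ball q r \ {q} with hBdef
  have hBo : IsOpen B := Metric.isOpen_ball.sdiff isClosed_singleton
  have hlocB : ∀ x ∈ B, LocPathConnectedAt x := fun x hx => hloc x hx.1 hx.2
  have hDo : ∀ x, IsOpen (pathComponentIn B x) :=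
    LocPathConnectedAt.isOpen_pathComponentIn hBo hlocB
  by_contra! hcon
  set S := Metric.sphere q (r / 2)
  have hS : IsCompact S := isCompact_sphere q (r / 2)
  have hSB : S ⊆ B := by
    intro x hx
    have hx' : dist x q = r / 2 := hx
    refine ⟨?_, ?_⟩
    · rw [Metric.mem_ball]; linarith
    · rintro rfl
      rw [dist_self] at hx'
      linarith
  have hcross : ∀ x ∈ A, x ∈ Metric.ball q (r / 2) → (pathComponentIn B x ∩ S).Nonempty := by
    intro x hxA hx
    have hxB : x ∈ B := ⟨Metric.ball_subset_ball (by linarith) hx, fun h => hq (h ▸ hxA)⟩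
    have hxD : x ∈ pathComponentIn B x := mem_pathComponentIn_self hxB
    -- Otherwise the component is clopen: its limit points stay in `B`, since `hcon` excludes `q`.
    -- By connectedness it would be the whole space, yet it misses `q`.
    have hout : ∃ z ∈ pathComponentIn B x, r / 2 < dist z q := by
      by_contra! hle
      have hcl : IsClosed (pathComponentIn B x) := by
        refine isClosed_of_closure_subset fun y hy => ?_
        have hy2 : dist y q ≤ r / 2 :=
          closure_minimal (t := {z | dist z q ≤ r / 2}) hle
            (isClosed_le (by fun_prop) (by fun_prop)) hy
        have hyB : y ∈ B := by
          refine ⟨?_, fun h => hcon x hxA (h ▸ hy)⟩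
          rw [Metric.mem_ball]; linarith
        exact (hlocB y hyB).mem_pathComponentIn_of_mem_closure hBo hyB hy
      have huniv := IsClopen.eq_univ ⟨hcl, hDo x⟩ ⟨x, hxD⟩
      have : q ∈ pathComponentIn B x := huniv ▸ mem_univ q
      exact (pathComponentIn_subset this).2 rfl
    obtain ⟨z, hzD, hz⟩ := hout
    have hpre : IsPreconnected (pathComponentIn B x) :=
      (isPathConnected_pathComponentIn hxB).isConnected.isPreconnected
    obtain ⟨w, hwD, hw⟩ := hpre.intermediate_value hxD hzD
      (f := fun z => dist z q) (by fun_prop) ⟨(Metric.mem_ball.1 hx).le, hz.le⟩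
    exact ⟨w, hwD, hw⟩
  -- Components are open and disjoint, so only finitely many meet the compact sphere. Closure
  -- commutes with their finite union, so one of them accumulates at `q`.
  obtain ⟨t, ht⟩ := hS.elim_finite_subcover (fun y : S => pathComponentIn B (y : X))
    (fun y => hDo y) fun y hy => mem_iUnion.2 ⟨⟨y, hy⟩, mem_pathComponentIn_self (hSB hy)⟩
  have hsub : A ∩ Metric.ball q (r / 2) ⊆ ⋃ y ∈ t, (pathComponentIn B (y : X) ∩ A) := by
    rintro x ⟨hxA, hx⟩
    obtain ⟨z, hzD, hzS⟩ := hcross x hxA hx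
    obtain ⟨y, hyt, hzy⟩ := mem_iUnion₂.1 (ht hzS)
    have hxz : x ∈ pathComponentIn B z := JoinedIn.symm hzD
    rw [pathComponentIn_congr hzy] at hxz
    exact mem_iUnion₂.2 ⟨y, hyt, hxz, hxA⟩
  have hq2 : q ∈ closure (A ∩ Metric.ball q (r / 2)) := by
    rw [mem_closure_iff_nhds] at hqA ⊢
    intro U hU
    obtain ⟨z, hz, hzA⟩ := hqA _ (inter_mem hU (Metric.ball_mem_nhds q (half_pos hr)))
    exact ⟨z, hz.1, hzA, hz.2⟩
  have hq3 := closure_mono hsub hq2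
  rw [Finset.closure_biUnion] at hq3
  obtain ⟨y, -, hy⟩ := mem_iUnion₂.1 hq3
  obtain ⟨x, hxy, hxA⟩ := closure_nonempty_iff.1 ⟨q, hy⟩
  refine hcon x hxA ?_
  rw [pathComponentIn_congr hxy]
  exact closure_mono inter_subset_left hy

/-- Each new point is chosen in the current component, so consecutive points are joined inside
punctured balls shrinking to `q`. -/
theorem mem_of_mem_closure_of_pathComponent_subset {q : X} {R : ℝ} (hR : 0 < R)
    (hloc : ∀ x ∈ Metric.ball q R, x ≠ q → LocPathConnectedAt x) {A : Set X} (hqA : q ∈ closure A)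
    (hA : ∀ x ∈ A, pathComponent x ⊆ A) : q ∈ A := by
  by_contra hq
  let B : ℕ → Set X := fun n => Metric.ball q (R / (n + 1)) \ {q}
  have hpos : ∀ n : ℕ, 0 < R / (n + 1 : ℝ) := fun n => by positivity
  have hanti : ∀ n : ℕ, R / ((n + 1 : ℕ) + 1 : ℝ) ≤ R / (n + 1 : ℝ) := fun n => by
    push_cast
    gcongr
    linarith
  have hle : ∀ n : ℕ, R / (n + 1 : ℝ) ≤ R := fun n =>
    div_le_self hR.le (by linarith [(Nat.cast_nonneg n : (0 : ℝ) ≤ n)])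
  have hlocn : ∀ n : ℕ, ∀ x ∈ Metric.ball q (R / (n + 1 : ℝ)), x ≠ q → LocPathConnectedAt x :=
    fun n x hx => hloc x (Metric.ball_subset_ball (hle n) hx)
  have hstart : ∃ x ∈ A, q ∈ closure (pathComponentIn (B 0) x) :=
    exists_pathComponentIn_punctured_ball (hpos 0) (hlocn 0) hqA hq
      fun x hx y hy => hA x hx (JoinedIn.joined hy)
  have hstep : ∀ (n : ℕ) (x : X), q ∈ closure (pathComponentIn (B n) x) →
      ∃ x' ∈ pathComponentIn (B n) x, q ∈ closure (pathComponentIn (B (n + 1)) x') := by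
    intro n x hx
    refine exists_pathComponentIn_punctured_ball (hpos (n + 1)) (hlocn (n + 1)) hx
      (fun h => (pathComponentIn_subset h).2 rfl) fun y hy z hz => JoinedIn.trans hy (hz.mono ?_)
    exact sdiff_subset_sdiff_left (Metric.ball_subset_ball (hanti n))
  obtain ⟨x₀, hx₀A, hx₀⟩ := hstart
  choose! next hnext hnext' using hstep
  let x : ℕ → X := fun n => Nat.rec x₀ next n
  have hx : ∀ n, q ∈ closure (pathComponentIn (B n) (x n)) := fun n => by
    induction n with
    | zero => exact hx₀
    | succ n ih => exact hnext' n _ ih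
  have hB : Tendsto B atTop (𝓝 q).smallSets := by
    rw [tendsto_smallSets_iff]
    intro U hU
    obtain ⟨ε, hε, hεU⟩ := Metric.mem_nhds_iff.1 hU
    have hlim : Tendsto (fun n : ℕ => R / (n + 1 : ℝ)) atTop (𝓝 0) :=
      tendsto_const_div_atTop_nhds_zero_nat R |>.comp (tendsto_add_atTop_nat 1) |>.congr
        fun n => by simp
    filter_upwards [hlim.eventually (Iio_mem_nhds hε)] with n hn
    exact sdiff_subset.trans ((Metric.ball_subset_ball (le_of_lt hn)).trans hεU)
  exact hq (hA x₀ hx₀A (Joined.of_tendsto_smallSets (x := x) hB fun n => hnext n _ (hx n)))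

/-- A connected compact metric space that is locally path-connected off a finite set is
path-connected. -/
theorem joined_of_locPathConnectedAt_compl_finite {F : Set X} (hF : F.Finite)
    (hloc : ∀ x ∉ F, LocPathConnectedAt x) (x y : X) : Joined x y := by
  have key : ∀ A : Set X, (∀ x ∈ A, pathComponent x ⊆ A) → IsClosed A := by
    refine fun A hA => isClosed_of_closure_subset fun q hq => ?_
    -- Finiteness of `F` isolates `q` from the other bad points.
    have hU : (F \ {q})ᶜ ∈ 𝓝 q := (hF.sdiff).isClosed.isOpen_compl.mem_nhds (by simp)
    obtain ⟨R, hR, hRU⟩ := Metric.mem_nhds_iff.1 hU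
    exact mem_of_mem_closure_of_pathComponent_subset hR
      (fun x hx hxq => hloc x fun hxF => hRU hx ⟨hxF, hxq⟩) hq hA
  have h1 : IsClosed (pathComponent x) := key _ fun z hz w hw => Joined.trans hz hw
  have h2 : IsClosed (pathComponent x)ᶜ :=
    key _ fun z hz w hw hxw => hz (Joined.trans hxw (Joined.symm hw))
  have h3 := IsClopen.eq_univ ⟨h1, isClosed_compl_iff.1 h2⟩ (pathComponent.nonempty x)
  exact (h3 ▸ mem_univ y : y ∈ pathComponent x)

end FinitelyManyBadPoints

/-- In a compact metrizable space that is locally path-connected off a finite set, the connected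
components are the path-components. -/
theorem connectedComponent_eq_pathComponent_of_compl_finite {X : Type*} [TopologicalSpace X]
    [TopologicalSpace.MetrizableSpace X] [CompactSpace X] {F : Set X} (hF : F.Finite)
    (hloc : ∀ x ∉ F, LocPathConnectedAt x) (x : X) : connectedComponent x = pathComponent x := by
  let := TopologicalSpace.metrizableSpaceMetric X
  refine Subset.antisymm (fun y hy => ?_) (pathComponent_subset_component x)
  let C := connectedComponent x
  have : CompactSpace C := isCompact_iff_compactSpace.1 isClosed_connectedComponent.isCompact
  have : PreconnectedSpace C := Subtype.preconnectedSpace isPreconnected_connectedComponent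
  have hlocC : ∀ z : C, z ∉ ((↑) ⁻¹' F : Set C) → LocPathConnectedAt z := by
    intro z hz U hU
    rw [nhds_induced] at hU
    obtain ⟨U', hU', hUU'⟩ := hU
    obtain ⟨V, hV, hVc, hVU⟩ := hloc z hz U' hU'
    -- `C` need not be open, but the connected neighbourhood `V` cannot leave it.
    have hVC : V ⊆ C := by
      have hz' : connectedComponent x = connectedComponent (z : X) := connectedComponent_eq z.2
      rw [show C = connectedComponent (z : X) from hz']
      exact hVc.isConnected.isPreconnected.subset_connectedComponent (mem_of_mem_nhds hV)
    exact ⟨(↑) ⁻¹' V, preimage_coe_mem_nhds_subtype.2 (mem_nhdsWithin_of_mem_nhds hV),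
      hVc.preimage_coe hVC, (preimage_mono hVU).trans hUU'⟩
  exact (joined_of_locPathConnectedAt_compl_finite
    (hF.preimage Subtype.val_injective.injOn) hlocC ⟨x, mem_connectedComponent⟩ ⟨y, hy⟩).map
    continuous_subtype_val

/-! ### Level sets near non-critical points -/

section LevelSets

/-- If `f` is the first coordinate of a local homeomorphism to `ℝ × G`, then its level sets are
locally path-connected at the points of the source. -/
theorem OpenPartialHomeomorph.locPathConnectedAt_level {M G : Type*} [TopologicalSpace M]
    [NormedAddCommGroup G] [NormedSpace ℝ G] (e : OpenPartialHomeomorph M (ℝ × G)) {f : M → ℝ}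
    (hf : ∀ z ∈ e.source, (e z).1 = f z) {y : ℝ} (x : f ⁻¹' {y}) (hx : (x : M) ∈ e.source) :
    LocPathConnectedAt x := by
  intro U hU
  rw [nhds_induced] at hU
  obtain ⟨U', hU', hUU'⟩ := hU
  obtain ⟨a, ha⟩ := x
  simp only at hx hU'
  have hfa : f a = y := ha
  have hN : e.target ∩ e.symm ⁻¹' U' ∈ 𝓝 (e a) := by
    refine inter_mem (e.open_target.mem_nhds (e.map_source hx)) ?_
    refine (e.continuousAt_symm (e.map_source hx)).preimage_mem_nhds ?_
    rwa [e.left_inv hx]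
  obtain ⟨ε, hε, hεN⟩ := Metric.mem_nhds_iff.1 hN
  rw [← Prod.mk.eta (p := e a), ← ball_prod_same, hf a hx, hfa] at hεN
  -- In the straightened coordinates the level set is a slice, convex within a product ball.
  let K : Set (ℝ × G) := {y} ×ˢ Metric.ball (e a).2 ε
  have hKN : K ⊆ e.target ∩ e.symm ⁻¹' U' :=
    (Set.prod_mono (singleton_subset_iff.2 (Metric.mem_ball_self hε)) Subset.rfl).trans hεN
  have hK : IsPathConnected K := ((convex_singleton y).prod (convex_ball _ _)).isPathConnected
    ⟨(y, (e a).2), rfl, Metric.mem_ball_self hε⟩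
  have himg : IsPathConnected (e.symm '' K) :=
    hK.image' (e.continuousOn_symm.mono fun p hp => (hKN hp).1)
  have hlev : e.symm '' K ⊆ f ⁻¹' {y} := by
    rintro _ ⟨p, hp, rfl⟩
    have hp' := (hKN hp).1
    rw [mem_preimage, ← hf _ (e.map_target hp'), e.right_inv hp']
    exact hp.1
  refine ⟨(↑) ⁻¹' (e.symm '' K), ?_, himg.preimage_coe hlev, ?_⟩
  · rw [nhds_induced]
    refine ⟨e.source ∩ e ⁻¹' (Prod.snd ⁻¹' Metric.ball (e a).2 ε), ?_, ?_⟩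
    · refine inter_mem (e.open_source.mem_nhds hx) ((e.continuousAt hx).preimage_mem_nhds ?_)
      exact continuous_snd.continuousAt.preimage_mem_nhds (Metric.ball_mem_nhds _ hε)
    · rintro ⟨z, hz⟩ ⟨hzs, hzb⟩
      exact ⟨e z, ⟨(hf z hzs).trans hz, hzb⟩, e.left_inv hzs⟩
  · refine Subset.trans ?_ hUU'
    rintro z ⟨p, hp, hpz⟩
    rw [mem_preimage, ← hpz]
    exact (hKN hp).2

/-- Level sets of a smooth function are locally path-connected at the non-critical points. -/
theorem locPathConnectedAt_level_of_notMem_criticalPoints {m : ℕ} {M : Type*} [TopologicalSpace M]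
    [ChartedSpace (EuclideanSpace ℝ (Fin m)) M] [IsManifold (𝓡 m) ∞ M]
    {f : M → ℝ} (hf : ContMDiff (𝓡 m) 𝓘(ℝ, ℝ) ∞ f) {y : ℝ} (x : f ⁻¹' {y})
    (hx : (x : M) ∉ criticalPoints (m := m) f) : LocPathConnectedAt x := by
  let E := EuclideanSpace ℝ (Fin m)
  let φ : OpenPartialHomeomorph M E := chartAt E (x : M)
  let g : E → ℝ := f ∘ φ.symm
  have hg : ContDiffAt ℝ ∞ g (φ x) := by
    have h := (contMDiffAt_iff.1 (hf x)).2
    simp only [modelWithCornersSelf_coe, range_id, contDiffWithinAt_univ] at h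
    exact h
  have hd : HasStrictFDerivAt g (fderiv ℝ g (φ x)) (φ x) := hg.hasStrictFDerivAt (by simp)
  have hne : fderiv ℝ g (φ x) ≠ 0 := by
    intro h0
    apply hx
    have hmd : MDifferentiableAt (𝓡 m) 𝓘(ℝ, ℝ) f x := (hf x).mdifferentiableAt (by simp)
    change mfderiv (𝓡 m) 𝓘(ℝ, ℝ) f x = 0
    -- Unfolds `mfderiv` to the derivative of `g`, which is `f` read in the chart.
    refine (if_pos hmd).trans ?_
    simp only [modelWithCornersSelf_coe, range_id, fderivWithin_univ]
    exact h0
  have hrange : (fderiv ℝ g (φ x)).range = ⊤ :=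
    LinearMap.range_eq_top.2 (LinearMap.surjective (fun h => hne (by ext v; exact DFunLike.congr_fun h v)))
  -- The implicit-function chart has `g` as first coordinate, so `e` has `f`.
  let e := φ.trans (hd.implicitToOpenPartialHomeomorph g _ hrange)
  refine e.locPathConnectedAt_level (fun z hz => ?_) x ?_
  · have hz' : z ∈ φ.source := hz.1
    change g (φ z) = f z
    exact congrArg f (φ.left_inv hz')
  · exact ⟨mem_chart_source E (x : M), hd.mem_implicitToOpenPartialHomeomorph_source hrange⟩

end LevelSets

theorem connectedComponentIn_eq_pathComponentIn {X : Type*} [TopologicalSpace X] {S : Set X}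
    (h : ∀ x : S, connectedComponent x = pathComponent x) (x : X) (hx : x ∈ S) :
    connectedComponentIn S x = pathComponentIn S x := by
  rw [connectedComponentIn_eq_image hx, h]
  ext y
  constructor
  · rintro ⟨z, hz, rfl⟩
    exact (joinedIn_iff_joined hx z.2).2 hz
  · intro hy
    exact ⟨⟨y, hy.target_mem⟩, hy.joined_subtype, rfl⟩

theorem proposition4p3 (m : ℕ) (M : Type*) [TopologicalSpace M] [T2Space M] [CompactSpace M]
    [ChartedSpace (EuclideanSpace ℝ (Fin m)) M] [IsManifold (𝓡 m) ∞ M]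
    (f : M → ℝ) (hf : ContMDiff (𝓡 m) 𝓘(ℝ, ℝ) ∞ f)
    (hcrit : (criticalPoints (m := m) f).Finite) :
    reebSetoid f = pathReebSetoid f ∧
    (∃ e : ReebSpace f ≃ₜ PathReebSpace f,
      (∀ x : M, e (ReebSpace.mk f x) = PathReebSpace.mk f x) ∧
      ∀ w : ReebSpace f, PathReebSpace.reebMap f (e w) = ReebSpace.reebMap f w) ∧
    ∀ (y : ℝ) (x : f ⁻¹' {y}), connectedComponent x = pathComponent x := by
  have : TopologicalSpace.MetrizableSpace M := Manifold.metrizableSpace (𝓡 m) M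
  have hcomp : ∀ (y : ℝ) (x : f ⁻¹' {y}), connectedComponent x = pathComponent x := by
    intro y
    have : CompactSpace (f ⁻¹' {y}) :=
      isCompact_iff_compactSpace.1 (isClosed_singleton.preimage hf.continuous).isCompact
    exact connectedComponent_eq_pathComponent_of_compl_finite
      (hcrit.preimage Subtype.val_injective.injOn)
      fun x hx => locPathConnectedAt_level_of_notMem_criticalPoints hf x hx
  have hrel : ∀ a b : M, reebSetoid f a b ↔ pathReebSetoid f a b := fun a b => by
    change _ ∧ _ ↔ _ ∧ _
    rw [connectedComponentIn_eq_pathComponentIn (hcomp (f a)) a rfl]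
  refine ⟨Setoid.ext hrel, ⟨?_, ?_, ?_⟩, hcomp⟩
  · exact
      { toEquiv := Quotient.congrRight hrel
        continuous_toFun := continuous_quot_lift _ continuous_quotient_mk'
        continuous_invFun := continuous_quot_lift _ continuous_quotient_mk' }
  · exact fun x => rfl
  · rintro ⟨x⟩
    rfl
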